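/- A tournament is an orientation of a complete graph, and a king of a tournament is a vertex from which every other vertex can be reached by a directed path of length at most $2$. In the $(k,n)$-king search problem the input is a tournament $T$ on $n$ vertices, and a correct answer is any set of $k$ kings of $T$, or $\bot$ if $T$ has fewer than $k$ kings. A deterministic algorithm is a finite decision tree whose inner nodes query the orientation of the edge between two vertices and whose leaves hold the answers. A randomized algorithm is a probability distribution on deterministic algorithms, and it solves the problem if on every tournament on $n$ vertices it answers correctly with probability at least $2/3$. **Theorem.** For every $k\ge 4$, any randomized algorithm that finds $k$ kings in an $n$-vertex tournament needs $\Omega(n^2)$ queries. Precisely: there are absolute constants $c>0$ and $n_0$ such that for all integers $k\ge 4$ and $n\ge\max(k,n_0)$ and every randomized algorithm that solves the $(k,n)$-king search problem, there is a tournament on $n$ vertices on which the expected number of queries of the algorithm is at least $c\,n^2$. -/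

import Mathlib

open scoped ENNReal

/-- A tournament: there are no loops, and for any two distinct vertices `u`, `v` there is exactly
one of the edges `u → v`, `v → u`. -/
def IsTournament {V : Type*} (T : Digraph V) : Prop :=
  (∀ v, ¬ T.Adj v v) ∧ ∀ u v, u ≠ v → (T.Adj u v ∨ T.Adj v u) ∧ ¬ (T.Adj u v ∧ T.Adj v u)

/-- `v` is a king: every other vertex can be reached from `v` by a path of length at most 2. -/
def IsKing {V : Type*} (T : Digraph V) (v : V) : Prop :=
  ∀ u, u ≠ v → T.Adj v u ∨ ∃ w, T.Adj v w ∧ T.Adj w u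

/-- Correct answers to the search problem for `k` kings: `some S` is correct if `S` is a set of
exactly `k` vertices, all of them kings; `none` (that is, `⊥`) is correct if there is no such set. -/
def IsSolution {V : Type*} (k : ℕ) (T : Digraph V) : Option (Finset V) → Prop
  | some S => S.card = k ∧ ∀ v ∈ S, IsKing T v
  | none => ¬ ∃ S : Finset V, S.card = k ∧ ∀ v ∈ S, IsKing T v

/-- Deterministic query algorithms for a search problem about tournaments on `V`: a leaf holds the
answer, and an inner node queries the orientation of the edge between `u` and `v`, continuing with
the first subtree if `u → v` and with the second one otherwise. -/
inductive DecisionTree (V : Type*) : Type _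
  | answer (out : Option (Finset V)) : DecisionTree V
  | query (u v : V) (ifYes ifNo : DecisionTree V) : DecisionTree V

namespace DecisionTree

open Classical in
/-- The answer that the algorithm gives on the input `T`. -/
noncomputable def output {V : Type*} (T : Digraph V) : DecisionTree V → Option (Finset V)
  | answer out => out
  | query u v ifYes ifNo => if T.Adj u v then ifYes.output T else ifNo.output T

open Classical in
/-- The number of queries that the algorithm makes on the input `T`. -/
noncomputable def numQueries {V : Type*} (T : Digraph V) : DecisionTree V → ℕ
  | answer _ => 0
  | query u v ifYes ifNo =>
      1 + if T.Adj u v then ifYes.numQueries T else ifNo.numQueries T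

end DecisionTree

/-- A randomized query algorithm: a random choice of a deterministic one. -/
abbrev RandomizedAlgorithm (V : Type*) := PMF (DecisionTree V)

namespace RandomizedAlgorithm

/-- The probability that the answer on the input `T` is a correct one. -/
noncomputable def successProb {V : Type*} (R : RandomizedAlgorithm V) (k : ℕ) (T : Digraph V) :
    ℝ≥0∞ :=
  R.toOuterMeasure {t | IsSolution k T (t.output T)}

/-- The expected number of queries on the input `T`. -/
noncomputable def expectedQueries {V : Type*} (R : RandomizedAlgorithm V) (T : Digraph V) :
    ℝ≥0∞ :=
  ∑' t : DecisionTree V, R t * (t.numQueries T : ℝ≥0∞)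

/-- `R` finds `k` kings: on every tournament on `V` it answers correctly with probability at
least `2 / 3`. -/
def FindsKings {V : Type*} (R : RandomizedAlgorithm V) (k : ℕ) : Prop :=
  ∀ T : Digraph V, IsTournament T → 2 / 3 ≤ R.successProb k T

end RandomizedAlgorithm

/-!
Only a sensitivity bound is needed. Suppose that reversing any one edge of a family `E` in a
tournament `T` changes whether `T` has fewer than `k` kings. The answers that are correct for `T`
are then wrong for each of the altered tournaments, so a randomized algorithm has to query each
edge of `E` on the input `T` with probability at least `1 / 3`, and it makes at least `|E| / 3`
queries in expectation (`exists_card_le_expectedQueries`). It remains to find such a `T` with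
quadratically many edges in `E`.

* For `k` at most about `n / 4` the tournament `fewKings` has exactly `k - 1` kings. Three of them,
  `a`, `b`, `c`, form a cycle; the others are those vertices `v i` that beat a private vertex `w j`,
  which is the only way to reach `a`. By default every `w j` beats every `v i`, and
  reversing any edge between an unused `w j` and a `v i` that is not a king makes `v i` a king.
* For larger `k` the tournament `manyKings` has exactly `k` kings, and they beat the `n - k` other
  vertices. Among the kings there are `a i` and `b i` for which `b j` is the only midpoint of a path
  of length two from `a j` to `a i` when `i < j`. Hence reversing the edge between `b j` and `a i`
  leaves `a j` without the crown.
-/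

open Classical in
/-- The edges that the algorithm queries on the input `T`. -/
noncomputable def DecisionTree.queried {V : Type*} (T : Digraph V) :
    DecisionTree V → Finset (Sym2 V)
  | answer _ => ∅
  | query u v ifYes ifNo =>
      insert s(u, v) (if T.Adj u v then ifYes.queried T else ifNo.queried T)

namespace DecisionTree

variable {V : Type*}

theorem card_queried_le (T : Digraph V) (t : DecisionTree V) :
    (t.queried T).card ≤ t.numQueries T := by
  classical
  induction t with
  | answer out => simp [queried, numQueries]
  | query u v y n hy hn =>
    simp only [queried, numQueries]
    refine (Finset.card_insert_le _ _).trans ?_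
    split_ifs <;> omega

theorem output_eq_of_agree {T T' : Digraph V} {e : Sym2 V}
    (h : ∀ u v, s(u, v) ≠ e → (T'.Adj u v ↔ T.Adj u v)) (t : DecisionTree V)
    (ht : e ∉ t.queried T) : t.output T' = t.output T := by
  induction t with
  | answer out => rfl
  | query u v y n hy hn =>
    simp only [queried, Finset.mem_insert, not_or] at ht
    by_cases huv : T.Adj u v
    · simpa [output, h u v (Ne.symm ht.1), huv] using hy (by simpa [huv] using ht.2)
    · simpa [output, h u v (Ne.symm ht.1), huv] using hn (by simpa [huv] using ht.2)

end DecisionTree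

namespace RandomizedAlgorithm

variable {V : Type*}

open Classical in
/-- If no answer is correct for both `T` and `T'`, then an algorithm that is right with probability
at least `2 / 3` on both has to look at the only edge where they differ: the two success
probabilities add up to `4 / 3`, so the two success events overlap. -/
theorem one_third_le_prob_queried (R : RandomizedAlgorithm V) {k : ℕ} {T T' : Digraph V}
    {e : Sym2 V} (hT : 2 / 3 ≤ R.successProb k T) (hT' : 2 / 3 ≤ R.successProb k T')
    (h : ∀ u v, s(u, v) ≠ e → (T'.Adj u v ↔ T.Adj u v))
    (hsol : ¬ (IsSolution k T none ↔ IsSolution k T' none)) :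
    (1 / 3 : ℝ≥0∞) ≤ ∑' t, if e ∈ t.queried T then R t else 0 := by
  have key : R.successProb k T + R.successProb k T' ≤
      1 + ∑' t, if e ∈ t.queried T then R t else 0 := by
    rw [successProb, successProb, PMF.toOuterMeasure_apply, PMF.toOuterMeasure_apply,
      ← R.tsum_coe, ← ENNReal.tsum_add, ← ENNReal.tsum_add]
    refine ENNReal.tsum_le_tsum fun t => ?_
    simp only [Set.indicator_apply, Set.mem_ofPred_eq]
    by_cases he : e ∈ t.queried T
    · rw [if_pos he]
      gcongr <;> split_ifs <;> simp
    · simp only [t.output_eq_of_agree h he]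
      have hno : ¬ (IsSolution k T (t.output T) ∧ IsSolution k T' (t.output T)) := by
        rintro ⟨h₁, h₂⟩
        cases ho : t.output T with
        | none => rw [ho] at h₁ h₂; exact hsol (iff_of_true h₁ h₂)
        | some S =>
          rw [ho] at h₁ h₂
          exact hsol (iff_of_false (fun hn => hn ⟨S, h₁⟩) (fun hn => hn ⟨S, h₂⟩))
      split_ifs <;> simp_all
  have h43 : (1 : ℝ≥0∞) + 1 / 3 ≤ 2 / 3 + 2 / 3 := by
    rw [ENNReal.div_add_div_same, ENNReal.le_div_iff_mul_le (by simp) (by simp), add_mul,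
      ENNReal.div_mul_cancel (by simp) (by simp)]
    norm_num
  exact (ENNReal.add_le_add_iff_left ENNReal.one_ne_top).1
    (h43.trans ((add_le_add hT hT').trans key))

/-- The sensitivity bound: `T' i` differs from `T` at most on the edge `e i`, and exactly one of
`T` and `T' i` has fewer than `k` kings. -/
theorem card_div_three_le_expectedQueries (R : RandomizedAlgorithm V) {k : ℕ}
    (hR : R.FindsKings k) {ι : Type*} [Fintype ι] {T : Digraph V} {T' : ι → Digraph V}
    {e : ι → Sym2 V} (he : Function.Injective e) (hT : IsTournament T)
    (hT' : ∀ i, IsTournament (T' i))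
    (h : ∀ i u v, s(u, v) ≠ e i → ((T' i).Adj u v ↔ T.Adj u v))
    (hsol : ∀ i, ¬ (IsSolution k T none ↔ IsSolution k (T' i) none)) :
    (Fintype.card ι : ℝ≥0∞) * (1 / 3) ≤ R.expectedQueries T := by
  classical
  calc (Fintype.card ι : ℝ≥0∞) * (1 / 3)
      = ∑ _i : ι, (1 / 3 : ℝ≥0∞) := by simp
    _ ≤ ∑ i : ι, ∑' t, if e i ∈ t.queried T then R t else 0 :=
        Finset.sum_le_sum fun i _ =>
          R.one_third_le_prob_queried (hR T hT) (hR _ (hT' i)) (h i) (hsol i)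
    _ = ∑' t, ∑ i : ι, if e i ∈ t.queried T then R t else 0 :=
        (Summable.tsum_finsetSum fun _ _ => ENNReal.summable).symm
    _ ≤ R.expectedQueries T := by
        refine ENNReal.tsum_le_tsum fun t => ?_
        rw [← Finset.sum_filter, Finset.sum_const, nsmul_eq_mul, mul_comm]
        gcongr
        refine le_trans ?_ (t.card_queried_le T)
        refine Finset.card_le_card_of_injOn e (fun i hi => ?_) he.injOn
        simpa using hi

end RandomizedAlgorithm

/-! ### Transport and counting of kings -/

section Transport

variable {U V : Type*}

/-- The digraph on `U` that corresponds to `T` under a relabelling `f` of the vertices. -/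
def relabel (f : U ≃ V) (T : Digraph V) : Digraph U where
  Adj u v := T.Adj (f u) (f v)

theorem IsTournament.relabel {T : Digraph V} (hT : IsTournament T) (f : U ≃ V) :
    IsTournament (relabel f T) :=
  ⟨fun v => hT.1 (f v), fun _ _ huv => hT.2 _ _ (f.injective.ne huv)⟩

theorem isKing_relabel (f : U ≃ V) (T : Digraph V) (u : U) :
    IsKing (relabel f T) u ↔ IsKing T (f u) := by
  simp only [IsKing, relabel, f.forall_congr_left, f.exists_congr_left, f.apply_symm_apply,
    ne_eq, f.symm_apply_eq]

theorem isSolution_none_relabel (f : U ≃ V) (T : Digraph V) (k : ℕ) :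
    IsSolution k (relabel f T) none ↔ IsSolution k T none := by
  refine not_congr ⟨?_, ?_⟩
  · rintro ⟨S, hS, hk⟩
    refine ⟨S.map f.toEmbedding, by simpa using hS, fun v hv => ?_⟩
    obtain ⟨u, hu, rfl⟩ := Finset.mem_map.1 hv
    exact (isKing_relabel f T u).1 (hk u hu)
  · rintro ⟨S, hS, hk⟩
    refine ⟨S.map f.symm.toEmbedding, by simpa using hS, fun v hv => ?_⟩
    obtain ⟨u, hu, rfl⟩ := Finset.mem_map.1 hv
    exact (isKing_relabel f T _).2 (by simpa using hk u hu)

theorem isSolution_none_of_card_lt {T : Digraph V} {k : ℕ} {ι : Type*} [Fintype ι] (f : ι → V)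
    (hk : Fintype.card ι < k) (h : ∀ v, IsKing T v → v ∈ Set.range f) :
    IsSolution k T none := by
  classical
  rintro ⟨S, rfl, hS⟩
  have hsub : S ⊆ Finset.univ.image f := fun v hv => by simpa using h v (hS v hv)
  exact absurd ((Finset.card_le_card hsub).trans Finset.card_image_le) (not_le.2 hk)

theorem not_isSolution_none_of_injective {T : Digraph V} {k : ℕ} {ι : Type*} [Fintype ι]
    {f : ι → V} (hf : Function.Injective f) (hk : Fintype.card ι = k)
    (h : ∀ i, IsKing T (f i)) : ¬ IsSolution k T none := by
  rw [IsSolution, not_not]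
  refine ⟨Finset.univ.map ⟨f, hf⟩, by simpa using hk, fun v hv => ?_⟩
  obtain ⟨i, -, rfl⟩ := Finset.mem_map.1 hv
  exact h i

/-- The sensitivity bound for a family of tournaments on any vertex type with `n` elements. -/
theorem exists_card_le_expectedQueries {n k : ℕ} {R : RandomizedAlgorithm (Fin n)}
    (hR : R.FindsKings k) (f : Fin n ≃ V) {ι : Type*} [Fintype ι] {T : Digraph V}
    {T' : ι → Digraph V} {e : ι → Sym2 V} (he : Function.Injective e) (hT : IsTournament T)
    (hT' : ∀ i, IsTournament (T' i))
    (h : ∀ i u v, s(u, v) ≠ e i → ((T' i).Adj u v ↔ T.Adj u v))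
    (hsol : ∀ i, ¬ (IsSolution k T none ↔ IsSolution k (T' i) none)) :
    ∃ T : Digraph (Fin n), IsTournament T ∧
      (Fintype.card ι : ℝ≥0∞) * (1 / 3) ≤ R.expectedQueries T := by
  refine ⟨relabel f T, hT.relabel f, R.card_div_three_le_expectedQueries hR
    (T' := fun i => relabel f (T' i)) (e := fun i => (e i).map f.symm)
    ((Sym2.map.injective f.symm.injective).comp he) (hT.relabel f)
    (fun i => (hT' i).relabel f) (fun i u v huv => h i _ _ fun hc => huv ?_) fun i => ?_⟩
  · rw [← hc]; simp
  · rw [isSolution_none_relabel, isSolution_none_relabel]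
    exact hsol i

end Transport

/-! ### Few kings: a hidden edge creates a king -/

/-- The vertices of `fewKings`. -/
inductive FewVertex (s t : ℕ)
  | a | b | c
  | v (i : Fin s)
  | w (j : Fin t)

namespace FewVertex

variable {s t : ℕ}

def equivSum (s t : ℕ) : FewVertex s t ≃ Option (Option (Option (Fin s ⊕ Fin t))) where
  toFun
    | a => none
    | b => some none
    | c => some (some none)
    | v i => some (some (some (.inl i)))
    | w j => some (some (some (.inr j)))
  invFun
    | none => a
    | some none => b
    | some (some none) => c
    | some (some (some (.inl i))) => v i
    | some (some (some (.inr j))) => w j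
  left_inv := by rintro (_ | _ | _ | _ | _) <;> rfl
  right_inv := by rintro (_ | _ | _ | _ | _) <;> rfl

end FewVertex

open FewVertex in
/-- The edges `b → a → c → b`, and the `v i` are beaten by `a` and `b` but beat `c`, whereas the
`w j` are beaten by `b` and `c` but beat `a`. Among themselves the `v i`, and also the `w j`, are
ordered transitively. The relation `M` says which `v i` beat which `w j`. -/
def fewKings {s t : ℕ} (M : Fin s → Fin t → Prop) : Digraph (FewVertex s t) where
  Adj
    | b, a => True
    | a, c => True
    | c, b => True
    | a, v _ => True
    | b, v _ => True
    | v _, c => True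
    | w _, a => True
    | b, w _ => True
    | c, w _ => True
    | v i, v i' => i < i'
    | w j, w j' => j < j'
    | v i, w j => M i j
    | w j, v i => ¬ M i j
    | _, _ => False

namespace FewVertex

variable {s t : ℕ} {M : Fin s → Fin t → Prop}

theorem isTournament_fewKings (M : Fin s → Fin t → Prop) : IsTournament (fewKings M) := by
  refine ⟨?_, ?_⟩
  · rintro (_ | _ | _ | i | j) <;> simp [fewKings]
  · rintro (_ | _ | _ | i | j) (_ | _ | _ | i' | j') <;> simp [fewKings] <;> grind

theorem isKing_a : IsKing (fewKings M) a := by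
  rintro (_ | _ | _ | i | j) h
  · exact absurd rfl h
  · exact .inr ⟨c, trivial, trivial⟩
  · exact .inl trivial
  · exact .inl trivial
  · exact .inr ⟨c, trivial, trivial⟩

theorem isKing_b : IsKing (fewKings M) b := by
  rintro (_ | _ | _ | i | j) h
  · exact .inl trivial
  · exact absurd rfl h
  · exact .inr ⟨a, trivial, trivial⟩
  · exact .inl trivial
  · exact .inl trivial

theorem isKing_c : IsKing (fewKings M) c := by
  rintro (_ | _ | _ | i | j) h
  · exact .inr ⟨b, trivial, trivial⟩
  · exact .inl trivial
  · exact absurd rfl h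
  · exact .inr ⟨b, trivial, trivial⟩
  · exact .inl trivial

/-- A private `w j` gives `v i` access to `a` and to all other `v i'`. -/
theorem isKing_v {i : Fin s} {j : Fin t} (hij : M i j) (hj : ∀ i', i' ≠ i → ¬ M i' j) :
    IsKing (fewKings M) (v i) := by
  rintro (_ | _ | _ | i' | j') h
  · exact .inr ⟨w j, hij, trivial⟩
  · exact .inr ⟨c, trivial, trivial⟩
  · exact .inl trivial
  · exact .inr ⟨w j, hij, hj i' fun hi => h (hi ▸ rfl)⟩
  · exact .inr ⟨c, trivial, trivial⟩

/-- Without a `w j` below it, `v i` cannot reach `a`. -/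
theorem exists_of_isKing_v {i : Fin s} (h : IsKing (fewKings M) (v i)) : ∃ j, M i j := by
  rcases h a (by simp) with h | ⟨_ | _ | _ | i' | j, h₁, h₂⟩
  · exact h.elim
  · exact h₂.elim
  · exact h₁.elim
  · exact h₂.elim
  · exact h₂.elim
  · exact ⟨j, h₁⟩

/-- No `w j` reaches `b`, since `b` is beaten by `c` only. -/
theorem not_isKing_w (j : Fin t) : ¬ IsKing (fewKings M) (w j) := by
  intro h
  rcases h b (by simp) with h | ⟨_ | _ | _ | i' | j, h₁, h₂⟩
  · exact h
  · exact h₂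
  · exact h₂
  · exact h₁
  · exact h₂
  · exact h₂

end FewVertex

open FewVertex in
/-- Here `v i` beats `w i` for `i < p = k - 4`, which gives exactly `k - 1` kings, and every edge
between a `v i` and a `w j` with `p ≤ i` and `p ≤ j` is sensitive. -/
theorem exists_expectedQueries_of_few {n k p s t : ℕ} {R : RandomizedAlgorithm (Fin n)}
    (hR : R.FindsKings k) (hk : k = p + 4) (hs : p ≤ s) (ht : p ≤ t) (hn : n = s + t + 3) :
    ∃ T : Digraph (Fin n), IsTournament T ∧
      (((s - p) * (t - p) : ℕ) : ℝ≥0∞) * (1 / 3) ≤ R.expectedQueries T := by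
  obtain ⟨s, rfl⟩ := Nat.exists_eq_add_of_le hs
  obtain ⟨t, rfl⟩ := Nat.exists_eq_add_of_le ht
  let M : Fin (p + s) → Fin (p + t) → Prop := fun i j => (i : ℕ) = j ∧ (i : ℕ) < p
  let M' : Fin s × Fin t → Fin (p + s) → Fin (p + t) → Prop :=
    fun x i j => M i j ∨ (i = Fin.natAdd p x.1 ∧ j = Fin.natAdd p x.2)
  have f : Fin n ≃ FewVertex (p + s) (p + t) :=
    (Fintype.equivFinOfCardEq (by simp; omega)).symm.trans (equivSum _ _).symm
  have key := exists_card_le_expectedQueries hR f (T := fewKings M)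
    (T' := fun x => fewKings (M' x)) (ι := Fin s × Fin t)
    (e := fun x => s(v (Fin.natAdd p x.1), w (Fin.natAdd p x.2))) ?_
    (isTournament_fewKings _) (fun _ => isTournament_fewKings _) ?_ ?_
  · simpa using key
  · rintro ⟨i, j⟩ ⟨i', j'⟩ h
    simpa using h
  · rintro ⟨i₀, j₀⟩ (_ | _ | _ | i | j) (_ | _ | _ | i' | j') h <;>
      simp [fewKings, M'] at h ⊢ <;> grind
  · rintro ⟨i₀, j₀⟩ h
    refine not_isSolution_none_of_injective (T := fewKings (M' (i₀, j₀)))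
      (ι := Option (Option (Option (Option (Fin p)))))
      (f := fun
        | none => a
        | some none => b
        | some (some none) => c
        | some (some (some none)) => v (Fin.natAdd p i₀)
        | some (some (some (some i))) => v (Fin.castAdd s i)) ?_ (by simp; omega) ?_ (h.1 ?_)
    · rintro (_ | _ | _ | _ | i) (_ | _ | _ | _ | i') hii <;> simp [Fin.ext_iff] at hii ⊢ <;> omega
    · rintro (_ | _ | _ | _ | i)
      · exact isKing_a
      · exact isKing_b
      · exact isKing_c
      · refine isKing_v (j := Fin.natAdd p j₀) (by simp [M']) fun i' hi' => ?_
        simp [M', M, Fin.ext_iff] at hi' ⊢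
        omega
      · refine isKing_v (j := Fin.castAdd t i) (by simp [M', M]) fun i' hi' => ?_
        simp [M', M, Fin.ext_iff] at hi' ⊢
        omega
    · refine isSolution_none_of_card_lt (ι := Option (Option (Option (Fin p))))
        (f := fun
          | none => a
          | some none => b
          | some (some none) => c
          | some (some (some i)) => v (Fin.castAdd s i)) (by simp; omega) ?_
      rintro (_ | _ | _ | i | j) hv
      · exact ⟨none, rfl⟩
      · exact ⟨some none, rfl⟩
      · exact ⟨some (some none), rfl⟩
      · obtain ⟨j, -, hi⟩ := exists_of_isKing_v hv
        exact ⟨some (some (some ⟨i, hi⟩)), rfl⟩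
      · exact absurd hv (not_isKing_w j)

/-! ### Many kings: a critical edge destroys a king -/

/-- The kings of `manyKings`. -/
inductive ManyVertex (m ε : ℕ)
  | a (i : Fin m)
  | b (i : Fin m)
  | s
  | z (l : Fin ε)

namespace ManyVertex

def equivSum (m ε : ℕ) : ManyVertex m ε ≃ Option ((Fin m ⊕ Fin m) ⊕ Fin ε) where
  toFun
    | a i => some (.inl (.inl i))
    | b i => some (.inl (.inr i))
    | s => none
    | z l => some (.inr l)
  invFun
    | some (.inl (.inl i)) => a i
    | some (.inl (.inr i)) => b i
    | none => s
    | some (.inr l) => z l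
  left_inv := by rintro (_ | _ | _ | _) <;> rfl
  right_inv := by rintro (_ | (_ | _) | _) <;> rfl

instance (m ε : ℕ) : Fintype (ManyVertex m ε) := Fintype.ofEquiv _ (equivSum m ε).symm

theorem card (m ε : ℕ) : Fintype.card (ManyVertex m ε) = 2 * m + 1 + ε := by
  rw [Fintype.card_congr (equivSum m ε)]
  simp
  omega

end ManyVertex

open ManyVertex in
/-- The `a i` are ordered upwards and the `b i` downwards; `s` is beaten by the `b i` and beats the
`a i`; the vertices `z l` (there is at most one of them, to adjust parity) are beaten by the `a i`
and beat the `b i` and `s`. All of these beat the remaining `d` vertices, which are ordered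
transitively. The relation `M` says which `a i` beat which `b j`. -/
def manyKings {m : ℕ} (ε d : ℕ) (M : Fin m → Fin m → Prop) :
    Digraph (ManyVertex m ε ⊕ Fin d) where
  Adj
    | .inl (a i), .inl (a i') => i < i'
    | .inl (b i), .inl (b i') => i' < i
    | .inl (a i), .inl (b j) => M i j
    | .inl (b j), .inl (a i) => ¬ M i j
    | .inl s, .inl (a _) => True
    | .inl (b _), .inl s => True
    | .inl (a _), .inl (z _) => True
    | .inl (z _), .inl (b _) => True
    | .inl (z _), .inl s => True
    | .inl (z l), .inl (z l') => l < l'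
    | .inl _, .inr _ => True
    | .inr x, .inr y => x < y
    | _, _ => False

namespace ManyVertex

variable {m ε d : ℕ} {M : Fin m → Fin m → Prop}

theorem isTournament_manyKings (M : Fin m → Fin m → Prop) :
    IsTournament (manyKings ε d M) := by
  refine ⟨?_, ?_⟩
  · rintro ((i | i | _ | l) | x) <;> simp [manyKings]
  · rintro ((i | i | _ | l) | x) ((i' | i' | _ | l') | x') <;> simp [manyKings] <;> grind

/-- If `a i` beats `b i` and no other `b j`, then all vertices but the last `d` are kings. -/
theorem isKing_inl (hm : 2 ≤ m) (hε : ε ≤ 1) (u : ManyVertex m ε) :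
    IsKing (manyKings ε d (fun i j : Fin m => i = j)) (.inl u) := by
  have hother (i : Fin m) : ∃ j : Fin m, j ≠ i :=
    haveI : Nontrivial (Fin m) := Fin.nontrivial_iff_two_le.2 hm
    exists_ne i
  have i₀ : Fin m := ⟨0, by omega⟩
  rintro (u' | x) huu'
  swap
  · rcases u with _ | _ | _ | _ <;> exact .inl trivial
  rcases u with i | i | _ | l <;> rcases u' with i' | i' | _ | l'
  · rcases lt_trichotomy i i' with h | rfl | h
    · exact .inl h
    · exact absurd rfl huu'
    · exact .inr ⟨.inl (b i), rfl, h.ne⟩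
  · rcases lt_trichotomy i i' with h | rfl | h
    · exact .inr ⟨.inl (a i'), h, rfl⟩
    · exact .inl rfl
    · exact .inr ⟨.inl (b i), rfl, h⟩
  · exact .inr ⟨.inl (b i), rfl, trivial⟩
  · exact .inl trivial
  · exact .inr ⟨.inl s, trivial, trivial⟩
  · rcases lt_trichotomy i i' with h | rfl | h
    · exact .inr ⟨.inl (a i'), h.ne', rfl⟩
    · exact absurd rfl huu'
    · exact .inl h
  · exact .inl trivial
  · obtain ⟨j, hj⟩ := hother i
    exact .inr ⟨.inl (a j), hj, trivial⟩
  · exact .inl trivial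
  · exact .inr ⟨.inl (a i'), trivial, rfl⟩
  · exact absurd rfl huu'
  · exact .inr ⟨.inl (a i₀), trivial, trivial⟩
  · exact .inr ⟨.inl s, trivial, trivial⟩
  · exact .inl trivial
  · exact .inl trivial
  · have : l' = l := Fin.ext (by omega)
    exact absurd (this ▸ rfl) huu'

theorem not_isKing_inr (x : Fin d) : ¬ IsKing (manyKings ε d M) (.inr x) := by
  intro h
  rcases h (.inl s) (by simp) with h | ⟨u | y, h₁, h₂⟩
  · exact h
  · exact h₁
  · exact h₂

/-- If all `b l` below `a j` are also below `a i`, where `i < j`, then `a j` cannot reach `a i`. -/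
theorem not_isKing_a {i j : Fin m} (hij : i < j) (h : ∀ l, M j l → M i l) :
    ¬ IsKing (manyKings ε d M) (.inl (a j)) := by
  intro hk
  rcases hk (.inl (a i)) (by simpa using hij.ne) with hk | ⟨(l | l | _ | l) | y, h₁, h₂⟩
  · exact hij.asymm hk
  · exact lt_asymm hij (lt_trans h₁ h₂)
  · exact h₂ (h l h₁)
  · exact h₁
  · exact h₂
  · exact h₂

end ManyVertex

open ManyVertex in
/-- There are `m = 2 * h + r` pairs `a i`, `b i` and exactly `k` kings; each edge between `a i` and
`b j` with `i` in the first block of `h` indices and `j` in the second one is sensitive. -/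
theorem exists_expectedQueries_of_many {n k h r ε d : ℕ} {R : RandomizedAlgorithm (Fin n)}
    (hR : R.FindsKings k) (hε : ε ≤ 1) (hh : 1 ≤ h) (hk : k = 2 * (h + (h + r)) + 1 + ε)
    (hn : n = k + d) :
    ∃ T : Digraph (Fin n), IsTournament T ∧
      ((h * h : ℕ) : ℝ≥0∞) * (1 / 3) ≤ R.expectedQueries T := by
  let lo : Fin h → Fin (h + (h + r)) := Fin.castAdd (h + r)
  let hi : Fin h → Fin (h + (h + r)) := fun j => Fin.natAdd h (Fin.castAdd r j)
  let M' : Fin h × Fin h → Fin (h + (h + r)) → Fin (h + (h + r)) → Prop :=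
    fun x i j => i = j ∨ (i = lo x.1 ∧ j = hi x.2)
  have hlt (i j : Fin h) : lo i < hi j := by simp [lo, hi, Fin.lt_def]; omega
  have f : Fin n ≃ ManyVertex (h + (h + r)) ε ⊕ Fin d :=
    (Fintype.equivFinOfCardEq (by simp [ManyVertex.card]; omega)).symm
  have key := exists_card_le_expectedQueries hR f (T := manyKings ε d fun i j => i = j)
    (T' := fun x => manyKings ε d (M' x)) (ι := Fin h × Fin h)
    (e := fun x => s(.inl (a (lo x.1)), .inl (b (hi x.2)))) ?_
    (isTournament_manyKings _) (fun _ => isTournament_manyKings _) ?_ ?_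
  · simpa using key
  · rintro ⟨i, j⟩ ⟨i', j'⟩ h
    simpa [lo, hi] using h
  · rintro ⟨i₀, j₀⟩ ((_ | _ | _ | _) | _) ((_ | _ | _ | _) | _) h <;>
      simp [manyKings, M'] at h ⊢ <;> grind
  · rintro ⟨i₀, j₀⟩ h
    refine not_isSolution_none_of_injective (T := manyKings ε d fun i j => i = j)
      (f := Sum.inl) Sum.inl_injective (by rw [ManyVertex.card, hk])
      (isKing_inl (by omega) hε) (h.2 ?_)
    classical
    refine isSolution_none_of_card_lt (ι := {u : ManyVertex _ ε // u ≠ a (hi j₀)})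
      (f := fun u => .inl u.1) ?_ ?_
    · have := Fintype.card_subtype_lt (p := fun u : ManyVertex _ ε => u ≠ a (hi j₀))
        (x := a (hi j₀)) (by simp)
      rwa [ManyVertex.card, ← hk] at this
    · rintro (u | x) hu
      · refine ⟨⟨u, ?_⟩, rfl⟩
        rintro rfl
        refine not_isKing_a (hlt i₀ j₀) (fun l hl => .inr ⟨rfl, ?_⟩) hu
        rcases hl with hl | ⟨hl, -⟩
        · exact hl.symm
        · exact absurd hl (hlt i₀ j₀).ne'
      · exact absurd hu (not_isKing_inr x)

/-! ### The quadratic lower bound -/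

theorem ofReal_mul_sq_le {n N : ℕ} (h : n ^ 2 ≤ 4096 * N) :
    ENNReal.ofReal (1 / 12288 * (n : ℝ) ^ 2) ≤ (N : ℝ≥0∞) * (1 / 3) := by
  have h' : (n : ℝ) ^ 2 ≤ 4096 * N := by exact_mod_cast h
  calc ENNReal.ofReal (1 / 12288 * (n : ℝ) ^ 2)
      ≤ ENNReal.ofReal (N * (1 / 3)) := ENNReal.ofReal_le_ofReal (by linarith)
    _ = (N : ℝ≥0∞) * (1 / 3) := by
        rw [ENNReal.ofReal_mul (by positivity), ENNReal.ofReal_natCast,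
          ENNReal.ofReal_div_of_pos (by norm_num)]
        simp

theorem theorem1p3 :
    ∃ c : ℝ, 0 < c ∧ ∃ n₀ : ℕ, ∀ k : ℕ, 4 ≤ k → ∀ n : ℕ, n₀ ≤ n → k ≤ n →
      ∀ R : RandomizedAlgorithm (Fin n), RandomizedAlgorithm.FindsKings R k →
        ∃ T : Digraph (Fin n), IsTournament T ∧
          ENNReal.ofReal (c * (n : ℝ) ^ 2) ≤ RandomizedAlgorithm.expectedQueries R T := by
  -- In both cases there are at least `(n / 64) ^ 2` sensitive edges, and `12288 = 3 * 64 ^ 2`.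
  refine ⟨1 / 12288, by norm_num, 100, fun k hk n hn hkn R hR => ?_⟩
  by_cases hsmall : 4 * (k - 4) ≤ n
  · obtain ⟨T, hT, hq⟩ := exists_expectedQueries_of_few hR (p := k - 4) (s := n / 2)
      (t := n - n / 2 - 3) (by omega) (by omega) (by omega) (by omega)
    refine ⟨T, hT, (ofReal_mul_sq_le ?_).trans hq⟩
    have h₁ : n ≤ 64 * (n / 2 - (k - 4)) := by omega
    have h₂ : n ≤ 64 * (n - n / 2 - 3 - (k - 4)) := by omega
    calc n ^ 2 = n * n := sq n
      _ ≤ _ := Nat.mul_le_mul h₁ h₂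
      _ = _ := by ring
  · obtain ⟨T, hT, hq⟩ := exists_expectedQueries_of_many hR (h := (k - 1) / 4)
      (r := (k - 1) / 2 - 2 * ((k - 1) / 4)) (ε := (k - 1) % 2) (d := n - k)
      (by omega) (by omega) (by omega) (by omega)
    refine ⟨T, hT, (ofReal_mul_sq_le ?_).trans hq⟩
    have h₁ : n ≤ 64 * ((k - 1) / 4) := by omega
    calc n ^ 2 = n * n := sq n
      _ ≤ _ := Nat.mul_le_mul h₁ h₁
      _ = _ := by ring
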